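/- For a set $X$, a function clone on $X$ is a set of operations $X^k\to X$ ($k\ge 1$) that contains all projections and is closed under composition. Its $k$-ary part carries the subspace topology of the product topology on $X^{X^k}$ with $X$ discrete, and the clone carries the sum topology over all $k\ge 1$. A clone isomorphism is an arity-preserving bijection between two clones that is compatible with projections and composition; it is topological if it is a homeomorphism. For a structure $\mathcal A$, the polymorphism clone $\mathrm{Pol}(\mathcal A)$ is the function clone of all homomorphisms $\mathcal A^k\to\mathcal A$, $k\ge 1$. A countably infinite structure is $\omega$-categorical if all countable models of its first-order theory are isomorphic. There are countably infinite $\omega$-categorical structures $\mathcal A$ and $\mathcal B$, each in a countable relational language, such that $\mathrm{Pol}(\mathcal A)$ and $\mathrm{Pol}(\mathcal B)$ are isomorphic as clones, but not topologically isomorphic: no clone isomorphism $\mathrm{Pol}(\mathcal A)\to\mathrm{Pol}(\mathcal B)$ is a homeomorphism. -/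

import Mathlib

namespace FunctionClones

open scoped FirstOrder

/-- A function clone on `X`: for every arity `k ≥ 1` a set of `k`-ary operations on `X`,
containing all projections and closed under composition. -/
structure FunctionClone (X : Type*) where
  /-- The set of `k`-ary operations of the clone. -/
  ops : ∀ k : ℕ+, Set ((Fin k → X) → X)
  proj_mem : ∀ (k : ℕ+) (i : Fin k), (fun x => x i) ∈ ops k
  comp_mem : ∀ (n m : ℕ+) (f : (Fin n → X) → X) (g : Fin n → (Fin m → X) → X),
    f ∈ ops n → (∀ i, g i ∈ ops m) → (fun x => f (fun i => g i x)) ∈ ops m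

namespace FunctionClone

variable {X Y : Type*}

/-- The operations of a clone: the disjoint union over all arities `k ≥ 1`. -/
abbrev Operation (C : FunctionClone X) : Type _ := Σ k : ℕ+, C.ops k

/-- The `k`-ary operations carry the subspace topology of the product topology on `X ^ (X ^ k)`,
where `X` is discrete. The type `C.Operation` then carries the sum topology. -/
instance (C : FunctionClone X) (k : ℕ+) : TopologicalSpace (C.ops k) :=
  @instTopologicalSpaceSubtype _ (· ∈ C.ops k)
    (@Pi.topologicalSpace (Fin k → X) (fun _ => X) (fun _ => ⊥))

/-- The `i`-th projection of arity `k`, as an operation of the clone. -/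
def proj (C : FunctionClone X) (k : ℕ+) (i : Fin k) : C.ops k :=
  ⟨fun x => x i, C.proj_mem k i⟩

/-- The composition `f(g₁, …, gₙ)` in a clone. -/
def comp (C : FunctionClone X) {n m : ℕ+} (f : C.ops n) (g : Fin n → C.ops m) : C.ops m :=
  ⟨fun x => f.1 (fun i => (g i).1 x), C.comp_mem n m f.1 (fun i => (g i).1) f.2 fun i => (g i).2⟩

/-- A clone isomorphism: an arity-preserving bijection between the operations which is compatible
with projections and composition. -/
structure Iso (C : FunctionClone X) (D : FunctionClone Y) where
  /-- The bijection on `k`-ary operations. -/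
  toEquiv : ∀ k : ℕ+, C.ops k ≃ D.ops k
  map_proj : ∀ (k : ℕ+) (i : Fin k), toEquiv k (C.proj k i) = D.proj k i
  map_comp : ∀ (n m : ℕ+) (f : C.ops n) (g : Fin n → C.ops m),
    toEquiv m (C.comp f g) = D.comp (toEquiv n f) (fun i => toEquiv m (g i))

/-- The map on all operations underlying a clone isomorphism. -/
def Iso.toFun {C : FunctionClone X} {D : FunctionClone Y} (ξ : C.Iso D) :
    C.Operation → D.Operation :=
  fun f => ⟨f.1, ξ.toEquiv f.1 f.2⟩

/-- Two clones are isomorphic. -/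
def Isomorphic (C : FunctionClone X) (D : FunctionClone Y) : Prop :=
  Nonempty (C.Iso D)

/-- Two clones are topologically isomorphic: some clone isomorphism is a homeomorphism. -/
def TopologicallyIsomorphic (C : FunctionClone X) (D : FunctionClone Y) : Prop :=
  ∃ ξ : C.Iso D, IsHomeomorph ξ.toFun

end FunctionClone

/-- The power `A ^ ι` of a structure `A`: symbols are interpreted coordinatewise. -/
instance powerStructure (L : FirstOrder.Language) (A : Type*) [L.Structure A] (ι : Type*) :
    L.Structure (ι → A) where
  funMap f x := fun i => FirstOrder.Language.Structure.funMap f (fun j => x j i)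
  RelMap r x := ∀ i, FirstOrder.Language.Structure.RelMap r (fun j => x j i)

/-- The polymorphism clone of `A`: its `k`-ary operations are the homomorphisms `A ^ k → A`. -/
def Pol (L : FirstOrder.Language) (A : Type*) [L.Structure A] : FunctionClone A where
  ops k := {f | ∃ h : (Fin k → A) →[L] A, ⇑h = f}
  proj_mem k i := ⟨⟨fun x => x i, fun _ _ => rfl, fun _ _ h => h i⟩, rfl⟩
  comp_mem n m f g := by
    rintro ⟨h, rfl⟩ hg
    choose p hp using hg
    refine ⟨⟨fun x => h (fun i => p i x), fun s x => ?_, fun r x hx => ?_⟩, ?_⟩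
    · have : (fun i => p i (FirstOrder.Language.Structure.funMap s x))
          = FirstOrder.Language.Structure.funMap s (fun j i => p i (x j)) := by
        funext i
        exact (p i).map_fun s x
      rw [this]
      exact h.map_fun s _
    · exact h.map_rel r (fun j i => p i (x j)) fun i => (p i).map_rel r x hx
    · funext x
      simp only [← hp]
      rfl

/-- A structure `A` is `ω`-categorical if all countably infinite models of its first-order theory
are isomorphic. -/
def IsOmegaCategorical.{u, v, w} (L : FirstOrder.Language.{u, v}) (A : Type w) [L.Structure A] : Prop :=
  Cardinal.Categorical Cardinal.aleph0.{w} (L.completeTheory A)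

end FunctionClones

/-!
A closed function clone on a countable set is the polymorphism clone of a structure in a countable
relational language, and that structure is `ω`-categorical as soon as the invertible unary
operations of the clone have finitely many orbits on tuples of each length. So the task is to find
two such clones. Both consist of the operations `x ↦ a (x j)`, for `a` in a closed monoid of
transformations without constant maps; then isomorphisms and topological isomorphisms of the clones
come from those of the monoids.

The construction rests on a generic colouring of the finite subsets of `ℕ` by elements of `ℤ/2`.
An injection `e : ℕ → ℕ` has type `x : ℕ → ℤ/2` if it changes the colour of every `n`-element set
by `x n`. Types add up under composition, so that they form a compact group `Γ`, the sequences with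
`x 0 = 0`. By a back-and-forth argument, every type is the type of a permutation, and finite partial
maps of a type `x` extend to permutations of any type that agrees with `x` up to the size of the
domain.

For `κ ∈ ℤ/2`, the elements of the monoid `typedMonoid κ` are triples `(e, i, d)` of an injection
with a type, a sign `i ∈ ℤ/2` and a degree `d ∈ {0, 1, 2}`, with truncated addition of degrees. In
degree `0` only type and sign `0` are allowed. In degree `1` the pair of type and sign is
`(unit vector or 0, 0)` or `(u, κ)`, where `u = (0, 1, 1, 1, …)`. In degree `2` everything is
allowed. Truncation makes this closed under multiplication although the allowed pairs in degree `1`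
generate a non-closed subgroup of `Γ × ℤ/2`.

The limit along a nonprincipal ultrafilter is a discontinuous homomorphism `f : Γ → ℤ/2` that
vanishes on the unit vectors and has `f u = 1`. Hence `(e, i, d) ↦ (e, i + f (type e), d)` is an
isomorphism between `typedMonoid 1` and `typedMonoid 0` (`twistEquiv`).

Suppose that a continuous isomorphism from `typedMonoid 1` to `typedMonoid 0` exists. Elements of
degree `2` are recognized by means of the only nontrivial idempotent `(id, 0, 2)`, so degree `2` is
preserved. The sign is a continuous character of `typedMonoid 0` that is trivial in degrees `0` and
`1`, and its pullback to `typedMonoid 1` has the same properties. But there such a character is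
trivial (`character_eq_zero`): it vanishes on all types by continuity, since the unit vectors
generate a dense subgroup of `Γ`, and then the pair `(u, 1)` shows that it does not depend on the
sign.
-/

namespace FunctionClones

open FirstOrder FirstOrder.Language

/-! ### Back and forth -/

/-- The back-and-forth argument, for abstract states `s` with an underlying partial bijection
`G s`. Besides the bijection itself, the conclusion records that every finite part of it is
contained in the graph of some state. -/
theorem exists_equiv_of_back_and_forth {α β S : Type*} [Countable α] [Countable β]
    (G : S → Set (α × β))
    (inj : ∀ s, ∀ q ∈ G s, ∀ r ∈ G s, q.1 = r.1 ↔ q.2 = r.2)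
    (forth : ∀ s x, ∃ s' y, G s ⊆ G s' ∧ (x, y) ∈ G s')
    (back : ∀ s y, ∃ s' x, G s ⊆ G s' ∧ (x, y) ∈ G s') (s₀ : S) :
    ∃ g : α ≃ β, (∀ q ∈ G s₀, g q.1 = q.2) ∧
      ∀ t : Finset α, ∃ s, ∀ x ∈ t, (x, g x) ∈ G s := by
  classical
  have := Encodable.ofCountable (α ⊕ β)
  choose F fy hF hFy using forth
  choose B bx hB hBx using back
  let step : S → ℕ → S := fun s n => match Encodable.decode (α := α ⊕ β) n with
    | some (Sum.inl x) => F s x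
    | some (Sum.inr y) => B s y
    | none => s
  let seq : ℕ → S := fun n => Nat.rec s₀ (fun k s => step s k) n
  have hsucc : ∀ n, seq (n + 1) = step (seq n) n := fun n => rfl
  have hstep : ∀ n, G (seq n) ≤ G (seq (n + 1)) := by
    intro n
    rw [hsucc]
    simp only [step]
    rcases Encodable.decode (α := α ⊕ β) n with _ | x | y
    · exact le_rfl
    · exact hF _ _
    · exact hB _ _
  have hmono : Monotone fun n => G (seq n) := monotone_nat_of_le_succ hstep
  have hleft : ∀ x, ∃ n y, (x, y) ∈ G (seq n) := by
    intro x
    refine ⟨Encodable.encode (Sum.inl x : α ⊕ β) + 1,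
      fy (seq (Encodable.encode (Sum.inl x : α ⊕ β))) x, ?_⟩
    rw [hsucc]
    simp only [step, Encodable.encodek]
    exact hFy _ _
  have hright : ∀ y, ∃ n x, (x, y) ∈ G (seq n) := by
    intro y
    refine ⟨Encodable.encode (Sum.inr y : α ⊕ β) + 1,
      bx (seq (Encodable.encode (Sum.inr y : α ⊕ β))) y, ?_⟩
    rw [hsucc]
    simp only [step, Encodable.encodek]
    exact hBx _ _
  choose nx g hg using hleft
  choose ny g' hg' using hright
  have key : ∀ n m q r, q ∈ G (seq n) → r ∈ G (seq m) → (q.1 = r.1 ↔ q.2 = r.2) := by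
    intro n m q r hq hr
    exact inj _ q (hmono (le_max_left n m) hq) r (hmono (le_max_right n m) hr)
  refine ⟨⟨g, g', fun x => ?_, fun y => ?_⟩, fun q hq => ?_, fun t => ?_⟩
  · exact (key _ _ _ _ (hg' (g x)) (hg x)).2 rfl
  · exact (key _ _ _ _ (hg (g' y)) (hg' y)).1 rfl
  · exact (key _ 0 _ q (hg q.1) hq).1 rfl
  · refine ⟨seq (t.sup nx), fun x hx => ?_⟩
    exact hmono (Finset.le_sup hx) (hg x)

/-! ### Structures with an oligomorphic automorphism group -/

section Categorical

variable {L : FirstOrder.Language.{0, 0}}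

/-- Two tuples, possibly in different structures, satisfy the same first-order formulas. -/
def SameType {M N : Type*} [L.Structure M] [L.Structure N] {n : ℕ}
    (x : Fin n → M) (y : Fin n → N) : Prop :=
  ∀ φ : L.BoundedFormula Empty n, φ.Realize default x ↔ φ.Realize default y

/-- The automorphism group of `A` has finitely many orbits on `n`-tuples for every `n`: there is an
invariant of `n`-tuples with finitely many values that separates the orbits. -/
def Oligomorphic (L : FirstOrder.Language.{0, 0}) (A : Type) [L.Structure A] : Prop :=
  ∀ n, ∃ (τ : Type) (_ : Finite τ) (inv : (Fin n → A) → τ),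
    ∀ a b, inv a = inv b → ∃ g : A ≃[L] A, ∀ i, g (a i) = b i

variable {A : Type} [L.Structure A]

theorem SameType.of_equiv {n : ℕ} {a b : Fin n → A} (g : A ≃[L] A) (h : ∀ i, g (a i) = b i) :
    SameType (L := L) a b := by
  intro φ
  have := StrongHomClass.realize_boundedFormula g φ (v := default) (xs := a)
  rw [← this]
  have e : g ∘ a = b := funext h
  rw [e, Subsingleton.elim (g ∘ default : Empty → A) default]

/-- With finitely many orbits, the type of a tuple is implied by a single formula: the conjunction
of one formula per orbit that tells the tuple apart from that orbit. -/
theorem Oligomorphic.exists_isolating (h : Oligomorphic L A) {n : ℕ} (a : Fin n → A) :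
    ∃ φ : L.BoundedFormula Empty n, φ.Realize default a ∧
      ∀ b : Fin n → A, φ.Realize default b → SameType (L := L) a b := by
  classical
  obtain ⟨τ, _, inv, hinv⟩ := h n
  have hsep : ∀ v, ∃ ψ : L.BoundedFormula Empty n, ψ.Realize default a ∧
      ∀ b : Fin n → A, inv b = v → ψ.Realize default b → SameType (L := L) a b := by
    intro v
    by_cases hv : ∃ r, inv r = v ∧ ¬ SameType (L := L) a r
    · obtain ⟨r, hr, hne⟩ := hv
      have : ∃ ψ : L.BoundedFormula Empty n, ψ.Realize default a ∧ ¬ ψ.Realize default r := by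
        simp only [SameType, not_forall] at hne
        obtain ⟨ψ, hψ⟩ := hne
        by_cases h1 : ψ.Realize default a
        · exact ⟨ψ, h1, fun h2 => hψ (iff_of_true h1 h2)⟩
        · refine ⟨ψ.not, by simpa using h1, ?_⟩
          intro h2
          exact hψ (iff_of_false h1 (by simpa using h2))
      obtain ⟨ψ, h1, h2⟩ := this
      refine ⟨ψ, h1, fun b hb hψ => absurd ?_ h2⟩
      obtain ⟨g, hg⟩ := hinv b r (hb.trans hr.symm)
      exact (SameType.of_equiv g hg ψ).1 hψ
    · push Not at hv
      exact ⟨⊤, by simp, fun b hb _ => hv b hb⟩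
  choose ψ h1 h2 using hsep
  refine ⟨BoundedFormula.iInf ψ, ?_, fun b hb => ?_⟩
  · rw [BoundedFormula.realize_iInf]
    exact h1
  · rw [BoundedFormula.realize_iInf] at hb
    exact h2 _ b rfl (hb _)

theorem realize_alls_iff_of_model {M : Type} [L.Structure M] [M ⊨ L.completeTheory A] {n : ℕ}
    (φ : L.BoundedFormula Empty n) :
    (∀ x : Fin n → A, φ.Realize default x) ↔ ∀ x : Fin n → M, φ.Realize default x := by
  have := realize_iff_of_model_completeTheory A M φ.alls
  simp only [Sentence.Realize, BoundedFormula.realize_alls] at this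
  exact this.symm

/-- A formula isolating a type in `A` isolates the same type in all models of the theory. -/
theorem sameType_of_isolating {M : Type} [L.Structure M] [M ⊨ L.completeTheory A] {n : ℕ}
    {a : Fin n → A} {φ : L.BoundedFormula Empty n}
    (hφ : ∀ b : Fin n → A, φ.Realize default b → SameType (L := L) a b)
    {x : Fin n → M} (hx : φ.Realize default x) : SameType (L := L) a x := by
  have key : ∀ ψ : L.BoundedFormula Empty n, ψ.Realize default a → ψ.Realize default x := by
    intro ψ hψ
    have := (realize_alls_iff_of_model (M := M) (A := A) (φ.imp ψ)).1 (fun b hb => (hφ b hb ψ).1 hψ)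
    exact this x hx
  refine fun ψ => ⟨key ψ, fun h => ?_⟩
  by_contra hn
  exact (key ψ.not hn) h

/-- Every type realized in a model of the theory of `A` is realized in `A`. -/
theorem Oligomorphic.exists_sameType (h : Oligomorphic L A) {M : Type} [L.Structure M]
    [M ⊨ L.completeTheory A] {n : ℕ} (x : Fin n → M) :
    ∃ a : Fin n → A, SameType (L := L) a x := by
  classical
  obtain ⟨τ, _, inv, hinv⟩ := h n
  choose φ h1 h2 using fun a : Fin n → A => h.exists_isolating a
  let R := Set.range inv
  choose r hr using fun v : R => v.2
  have := (realize_alls_iff_of_model (M := M) (A := A)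
    (BoundedFormula.iSup fun v : R => φ (r v))).1 (by
      intro b
      rw [BoundedFormula.realize_iSup]
      refine ⟨⟨inv b, b, rfl⟩, ?_⟩
      obtain ⟨g, hg⟩ := hinv _ _ (hr ⟨inv b, b, rfl⟩)
      exact (SameType.of_equiv g hg _).1 (h1 _)) x
  rw [BoundedFormula.realize_iSup] at this
  obtain ⟨v, hv⟩ := this
  exact ⟨r v, sameType_of_isolating (h2 _) hv⟩

/-- The extension step of the back-and-forth argument between two models of the theory. -/
theorem Oligomorphic.forth (h : Oligomorphic L A) {M N : Type} [L.Structure M] [L.Structure N]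
    [M ⊨ L.completeTheory A] [N ⊨ L.completeTheory A] {n : ℕ} {x : Fin n → M} {y : Fin n → N}
    (hxy : SameType (L := L) x y) (x' : M) :
    ∃ y', SameType (L := L) (Fin.snoc x x' : Fin (n + 1) → M) (Fin.snoc y y' : Fin (n + 1) → N) := by
  obtain ⟨a, ha⟩ := h.exists_sameType (Fin.snoc x x' : Fin (n + 1) → M)
  obtain ⟨φ, h1, h2⟩ := h.exists_isolating a
  have hx : φ.ex.Realize default x := BoundedFormula.realize_ex.2 ⟨x', (ha φ).1 h1⟩
  obtain ⟨y', hy⟩ := BoundedFormula.realize_ex.1 ((hxy _).1 hx)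
  exact ⟨y', fun ψ => (ha ψ).symm.trans (sameType_of_isolating h2 hy ψ)⟩

theorem SameType.symm {M N : Type*} [L.Structure M] [L.Structure N] {n : ℕ}
    {x : Fin n → M} {y : Fin n → N} (h : SameType (L := L) x y) : SameType (L := L) y x :=
  fun φ => (h φ).symm

theorem SameType.eq_iff {M N : Type*} [L.Structure M] [L.Structure N] {n : ℕ}
    {x : Fin n → M} {y : Fin n → N} (h : SameType (L := L) x y) (i j : Fin n) :
    x i = x j ↔ y i = y j := by
  have := h (Term.bdEqual (Term.var (Sum.inr i)) (Term.var (Sum.inr j)))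
  simpa using this

theorem SameType.rel_iff {M N : Type*} [L.Structure M] [L.Structure N] {n k : ℕ}
    {x : Fin n → M} {y : Fin n → N} (h : SameType (L := L) x y) (R : L.Relations k)
    (i : Fin k → Fin n) :
    Structure.RelMap R (fun j => x (i j)) ↔ Structure.RelMap R (fun j => y (i j)) := by
  have := h (R.boundedFormula fun j => Term.var (Sum.inr (i j)))
  simpa [BoundedFormula.realize_rel] using this

/-- The direction of the theorem of Ryll-Nardzewski, Engeler and Svenonius that yields
`ω`-categoricity. -/
theorem Oligomorphic.isOmegaCategorical [L.IsRelational] (h : Oligomorphic L A) :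
    IsOmegaCategorical L A := by
  classical
  intro M N hM hN
  have : Countable M := Cardinal.mk_le_aleph0_iff.1 hM.le
  have : Countable N := Cardinal.mk_le_aleph0_iff.1 hN.le
  let S := {p : Σ n, (Fin n → M) × (Fin n → N) // SameType (L := L) p.2.1 p.2.2}
  let G : S → Set (M × N) := fun s => Set.range fun i => (s.1.2.1 i, s.1.2.2 i)
  have hsub : ∀ (n : ℕ) (x : Fin n → M) (y : Fin n → N) (x' : M) (y' : N)
      (hs : SameType (L := L) x y)
      (hs' : SameType (L := L) (Fin.snoc x x' : Fin (n + 1) → M) (Fin.snoc y y' : Fin (n + 1) → N)),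
      G ⟨⟨n, x, y⟩, hs⟩ ⊆ G ⟨⟨n + 1, Fin.snoc x x', Fin.snoc y y'⟩, hs'⟩ ∧
      (x', y') ∈ G ⟨⟨n + 1, Fin.snoc x x', Fin.snoc y y'⟩, hs'⟩ := by
    intro n x y x' y' hs hs'
    refine ⟨?_, Fin.last n, by simp⟩
    rintro _ ⟨i, rfl⟩
    exact ⟨i.castSucc, by simp⟩
  have h0 : SameType (L := L) (default : Fin 0 → M) (default : Fin 0 → N) := by
    intro φ
    have e1 := realize_iff_of_model_completeTheory A M φ.alls
    have e2 := realize_iff_of_model_completeTheory A N φ.alls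
    exact e1.trans e2.symm
  obtain ⟨g, -, hg⟩ := exists_equiv_of_back_and_forth G
    (by
      rintro ⟨⟨n, x, y⟩, hs⟩ _ ⟨i, rfl⟩ _ ⟨j, rfl⟩
      exact hs.eq_iff i j)
    (by
      rintro ⟨⟨n, x, y⟩, hs⟩ x'
      obtain ⟨y', hs'⟩ := h.forth hs x'
      exact ⟨⟨⟨_, _, _⟩, hs'⟩, y', hsub n x y x' y' hs hs'⟩)
    (by
      rintro ⟨⟨n, x, y⟩, hs⟩ y'
      obtain ⟨x', hs'⟩ := h.forth hs.symm y'
      exact ⟨⟨⟨_, _, _⟩, hs'.symm⟩, x', hsub n x y x' y' hs hs'.symm⟩)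
    ⟨⟨0, default, default⟩, h0⟩
  refine ⟨⟨g, fun f _ => isEmptyElim f, fun {k} R t => ?_⟩⟩
  obtain ⟨⟨⟨n, x, y⟩, hs⟩, hgs⟩ := hg (Finset.univ.image t)
  have hi : ∀ j, ∃ i, x i = t j ∧ y i = g (t j) := by
    intro j
    obtain ⟨i, hi⟩ := hgs (t j) (by simp)
    simp only [Prod.mk.injEq] at hi
    exact ⟨i, hi⟩
  choose i hx hy using hi
  have := hs.rel_iff R i
  simp only [hx, hy] at this
  exact this.symm

end Categorical

/-! ### Closed clones are polymorphism clones -/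

section Canonical

variable {A : Type} (C : FunctionClone A)

/-- A clone on `A` is closed if it contains every operation that agrees with some element of the
clone on each finite set of arguments. -/
def IsLocallyClosed {X : Type*} (C : FunctionClone X) : Prop :=
  ∀ (k : ℕ+) (f : (Fin k → X) → X),
    (∀ s : Finset (Fin k → X), ∃ g ∈ C.ops k, ∀ x ∈ s, g x = f x) → f ∈ C.ops k

/-- The relational language with an `n`-ary symbol for each `k × n` matrix over `A`, `k ≥ 1`. -/
def matrixLanguage (A : Type) : FirstOrder.Language.{0, 0} where
  Functions _ := Empty
  Relations n := Σ k : ℕ+, Fin k → Fin n → A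

instance : (matrixLanguage A).IsRelational := fun _ => inferInstanceAs (IsEmpty Empty)

instance [Countable A] : Countable (matrixLanguage A).Symbols :=
  inferInstanceAs (Countable ((Σ _ : ℕ, Empty) ⊕ (Σ n : ℕ, Σ k : ℕ+, Fin k → Fin n → A)))

/-- The canonical structure of a clone `C`: the symbol of a matrix `t` is interpreted as the
relation generated by the rows of `t` under `C`. -/
@[reducible] def canonicalStructure : (matrixLanguage A).Structure A where
  funMap f := f.elim
  RelMap r y := ∃ f ∈ C.ops r.1, ∀ j, y j = f fun i => r.2 i j

theorem pol_canonicalStructure (hC : IsLocallyClosed C) :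
    letI := canonicalStructure C
    Pol (matrixLanguage A) A = C := by
  let _ := canonicalStructure C
  have : (Pol (matrixLanguage A) A).ops = C.ops := by
    ext k f
    constructor
    · rintro ⟨h, rfl⟩
      refine hC k _ fun s => ?_
      let p : Fin s.card → Fin k → A := fun j => (s.equivFin.symm j).1
      obtain ⟨g, hg, hgp⟩ := h.map_rel (show (matrixLanguage A).Relations s.card from
        ⟨k, fun i j => p j i⟩) p fun i => ⟨fun x => x i, C.proj_mem k i, fun j => rfl⟩
      refine ⟨g, hg, fun x hx => ?_⟩
      have := hgp (s.equivFin ⟨x, hx⟩)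
      simpa [p] using this.symm
    · intro hf
      refine ⟨⟨f, fun s => s.elim, fun {n} r x hx => ?_⟩, rfl⟩
      choose g hg hgx using hx
      refine ⟨_, C.comp_mem k r.1 f g hf hg, fun j => ?_⟩
      exact congrArg f (funext fun i => hgx i j)
  cases hP : Pol (matrixLanguage A) A
  rw [hP] at this
  cases C
  simpa using this

/-- Permutations that lie in the clone together with their inverses are automorphisms of the
canonical structure. -/
theorem exists_canonical_equiv (g : A ≃ A)
    (hg : (fun x : Fin (1 : ℕ+) → A => g (x 0)) ∈ C.ops 1)
    (hg' : (fun x : Fin (1 : ℕ+) → A => g.symm (x 0)) ∈ C.ops 1) :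
    letI := canonicalStructure C
    ∃ h : A ≃[matrixLanguage A] A, ∀ x, h x = g x := by
  let _ := canonicalStructure C
  refine ⟨⟨g, fun f => f.elim, fun {n} r x => ⟨?_, ?_⟩⟩, fun _ => rfl⟩
  · rintro ⟨f, hf, hfx⟩
    refine ⟨_, C.comp_mem 1 r.1 _ (fun _ => f) hg' fun _ => hf, fun j => ?_⟩
    simp only [← hfx]
    simp
  · rintro ⟨f, hf, hfx⟩
    refine ⟨_, C.comp_mem 1 r.1 _ (fun _ => f) hg fun _ => hf, fun j => ?_⟩
    simp [hfx]

end Canonical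

/-! ### Continuity of clone isomorphisms -/

/-- Continuity of a clone isomorphism, in combinatorial terms: each value of the image of `f` is
determined by the values of `f` at finitely many arguments. -/
theorem FunctionClone.Iso.exists_finset_of_continuous {X Y : Type*} {C : FunctionClone X}
    {D : FunctionClone Y} (ξ : C.Iso D) (hξ : Continuous ξ.toFun) {k : ℕ+} (f : C.ops k)
    (y : Fin k → Y) :
    ∃ s : Finset (Fin k → X), ∀ g : C.ops k, (∀ x ∈ s, g.1 x = f.1 x) →
      (ξ.toEquiv k g).1 y = (ξ.toEquiv k f).1 y := by
  let _ : TopologicalSpace X := ⊥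
  let _ : TopologicalSpace Y := ⊥
  have : DiscreteTopology X := ⟨rfl⟩
  have : DiscreteTopology Y := ⟨rfl⟩
  have h1 : Continuous fun g : C.ops k => ξ.toEquiv k g := by
    have : Continuous fun g : C.ops k => (⟨k, ξ.toEquiv k g⟩ : D.Operation) :=
      hξ.comp continuous_sigmaMk
    exact (Topology.IsEmbedding.sigmaMk (σ := fun k : ℕ+ => D.ops k)).continuous_iff.2 this
  have h2 : Continuous fun g : D.ops k => g.1 y := (continuous_apply y).comp continuous_subtype_val
  have h3 : IsOpen {g : C.ops k | (ξ.toEquiv k g).1 y = (ξ.toEquiv k f).1 y} :=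
    (isOpen_discrete {(ξ.toEquiv k f).1 y}).preimage (h2.comp h1)
  obtain ⟨V, hV, hVe⟩ := isOpen_induced_iff.1 h3
  have hfV : f.1 ∈ V := by
    have : f ∈ Subtype.val ⁻¹' V := by rw [hVe]; exact rfl
    exact this
  obtain ⟨I, u, hu, hsub⟩ := isOpen_pi_iff.1 hV f.1 hfV
  refine ⟨I, fun g hg => ?_⟩
  have : g ∈ Subtype.val ⁻¹' V := hsub fun x hx => by rw [hg x hx]; exact (hu x hx).2
  rw [hVe] at this
  exact this

/-! ### A generic colouring of the finite subsets of `ℕ` -/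

/-- A sequence of finite families of finite sets in which every family occurs at arbitrarily large
indices. -/
def familySeq (v : ℕ) : Finset (Finset ℕ) :=
  (Encodable.decode (Nat.unpair v).1).getD ∅

theorem exists_familySeq_eq (K : Finset (Finset ℕ)) (m : ℕ) : ∃ v, m ≤ v ∧ familySeq v = K :=
  ⟨Nat.pair (Encodable.encode K) m, Nat.right_le_pair _ _, by simp [familySeq]⟩

/-- A colouring of all finite subsets of `ℕ` with two colours. The colour of a set with maximum `v`
says whether the remaining elements form a member of the `v`-th family of `familySeq`; the maximum
of the empty set counts as `0`. -/
def color (s : Finset ℕ) : ZMod 2 :=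
  if s.erase (s.sup id) ∈ familySeq (s.sup id) then 1 else 0

/-- Genericity of `color`: any prescription of the colours of the sets `insert v t`, where `t`
ranges over the subsets of a finite set `s`, is realized by some new point `v`. -/
theorem exists_color_insert_eq (s : Finset ℕ) (h : Finset ℕ → ZMod 2) :
    ∃ v ∉ s, ∀ t ⊆ s, color (insert v t) = h t := by
  obtain ⟨v, hv, hK⟩ := exists_familySeq_eq (s.powerset.filter fun t => h t = 1) (s.sup id + 1)
  have hlt : ∀ x ∈ s, x < v := fun x hx =>
    lt_of_lt_of_le (Nat.lt_succ_of_le (Finset.le_sup (f := id) hx)) hv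
  refine ⟨v, fun hvs => (hlt v hvs).false, fun t ht => ?_⟩
  have hsup : (insert v t).sup id = v := by
    rw [Finset.sup_insert]
    exact sup_eq_left.2 (Finset.sup_le fun x hx => (hlt x (ht hx)).le)
  have hvt : v ∉ t := fun hvt => (hlt v (ht hvt)).false
  rw [color, hsup, Finset.erase_insert hvt, hK]
  have h2 : ∀ z : ZMod 2, (if z = 1 then 1 else 0) = z := by decide
  simp only [Finset.mem_filter, Finset.mem_powerset, ht, true_and]
  exact h2 _

/-- The injection `e` has type `x` if it changes the colours of the `n`-element sets by `x n`. -/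
def HasType (e : ℕ → ℕ) (x : ℕ → ZMod 2) : Prop :=
  ∀ s : Finset ℕ, color (s.image e) = color s + x s.card

/-- A finite partial injection of `ℕ`, given by its graph `l`, that changes the colours of the
`n`-element subsets of its domain by `x n`. -/
structure IsPartialOfType (x : ℕ → ZMod 2) (l : Finset (ℕ × ℕ)) : Prop where
  inj : ∀ q ∈ l, ∀ r ∈ l, q.1 = r.1 ↔ q.2 = r.2
  color_eq : ∀ t ⊆ l, color (t.image Prod.snd) = color (t.image Prod.fst) + x t.card

namespace IsPartialOfType

variable {x : ℕ → ZMod 2} {l : Finset (ℕ × ℕ)}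

theorem swap (h : IsPartialOfType x l) : IsPartialOfType x (l.image Prod.swap) := by
  refine ⟨?_, fun t ht => ?_⟩
  · simp only [Finset.mem_image]
    rintro _ ⟨q, hq, rfl⟩ _ ⟨r, hr, rfl⟩
    exact (h.inj q hq r hr).symm
  · obtain ⟨t', ht', rfl⟩ := Finset.subset_image_iff.1 ht
    rw [Finset.image_image, Finset.image_image, Finset.card_image_of_injective _ Prod.swap_injective]
    have e := h.color_eq t' ht'
    change color (t'.image Prod.fst) = color (t'.image Prod.snd) + x t'.card
    rw [e, add_assoc, CharTwo.add_self_eq_zero, add_zero]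

theorem forth (h : IsPartialOfType x l) (u : ℕ) :
    ∃ l' v, l ⊆ l' ∧ (u, v) ∈ l' ∧ IsPartialOfType x l' := by
  by_cases hu : ∃ v, (u, v) ∈ l
  · obtain ⟨v, hv⟩ := hu
    exact ⟨l, v, subset_rfl, hv, h⟩
  push Not at hu
  -- For `t` in the range of `l`, the colour of `insert v t` is forced by the preimage of `t`.
  obtain ⟨v, hv, hc⟩ := exists_color_insert_eq (l.image Prod.snd) fun t =>
    color (insert u ((l.filter fun q => q.2 ∈ t).image Prod.fst)) + x (t.card + 1)
  have hv' : ∀ q ∈ l, q.2 ≠ v := fun q hq e => hv (Finset.mem_image.2 ⟨q, hq, e⟩)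
  have hu' : ∀ q ∈ l, q.1 ≠ u := by
    rintro ⟨a, b⟩ hq rfl
    exact hu b hq
  refine ⟨insert (u, v) l, v, Finset.subset_insert _ _, Finset.mem_insert_self _ _, ?_, ?_⟩
  · intro q hq r hr
    rw [Finset.mem_insert] at hq hr
    rcases hq with rfl | hq <;> rcases hr with rfl | hr
    · simp
    · exact iff_of_false (hu' r hr).symm (hv' r hr).symm
    · exact iff_of_false (hu' q hq) (hv' q hq)
    · exact h.inj q hq r hr
  · intro t ht
    by_cases huv : (u, v) ∈ t
    · obtain ⟨t', hn, rfl⟩ : ∃ t', (u, v) ∉ t' ∧ insert (u, v) t' = t :=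
        ⟨t.erase (u, v), Finset.notMem_erase _ _, Finset.insert_erase huv⟩
      have ht' : t' ⊆ l := fun q hq => by
        rcases Finset.mem_insert.1 (ht (Finset.mem_insert_of_mem hq)) with rfl | hq'
        · exact absurd hq hn
        · exact hq'
      have hfil : (l.filter fun q => q.2 ∈ t'.image Prod.snd) = t' := by
        ext q
        simp only [Finset.mem_filter, Finset.mem_image]
        refine ⟨?_, fun hq => ⟨ht' hq, q, hq, rfl⟩⟩
        rintro ⟨hq, r, hr, e⟩
        have e' := (h.inj r (ht' hr) q hq).2 e
        rwa [← Prod.ext e' e]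
      have hcard : (t'.image Prod.snd).card = t'.card :=
        Finset.card_image_of_injOn fun q hq r hr e =>
          Prod.ext ((h.inj q (ht' hq) r (ht' hr)).2 e) e
      rw [Finset.image_insert, Finset.image_insert, hc _ (Finset.image_subset_image ht'), hfil,
        hcard, Finset.card_insert_of_notMem hn]
    · refine h.color_eq t fun q hq => ?_
      rcases Finset.mem_insert.1 (ht hq) with rfl | hq'
      · exact absurd hq huv
      · exact hq'

theorem back (h : IsPartialOfType x l) (v : ℕ) :
    ∃ l' u, l ⊆ l' ∧ (u, v) ∈ l' ∧ IsPartialOfType x l' := by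
  obtain ⟨l', u, hl, hu, hl'⟩ := h.swap.forth v
  refine ⟨l'.image Prod.swap, u, fun q hq => ?_, Finset.mem_image.2 ⟨_, hu, rfl⟩, hl'.swap⟩
  exact Finset.mem_image.2 ⟨q.swap, hl (Finset.mem_image_of_mem _ hq), Prod.swap_swap q⟩

/-- Homogeneity of `color`: finite partial injections of a given type extend to permutations. -/
theorem exists_perm (h : IsPartialOfType x l) :
    ∃ g : Equiv.Perm ℕ, (∀ q ∈ l, g q.1 = q.2) ∧ HasType g x := by
  obtain ⟨g, h1, h2⟩ := exists_equiv_of_back_and_forth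
    (S := {l : Finset (ℕ × ℕ) // IsPartialOfType x l}) (fun l => (l.1 : Set (ℕ × ℕ)))
    (fun s => s.2.inj)
    (fun s u => by
      obtain ⟨l', v, hl, hv, h'⟩ := s.2.forth u
      exact ⟨⟨l', h'⟩, v, hl, hv⟩)
    (fun s v => by
      obtain ⟨l', u, hl, hv, h'⟩ := s.2.back v
      exact ⟨⟨l', h'⟩, u, hl, hv⟩) ⟨l, h⟩
  refine ⟨g, h1, fun s => ?_⟩
  obtain ⟨⟨l', h'⟩, hs⟩ := h2 s
  have hsub : s.image (fun a => (a, g a)) ⊆ l' := by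
    intro q hq
    obtain ⟨a, ha, rfl⟩ := Finset.mem_image.1 hq
    exact hs a ha
  have := h'.color_eq _ hsub
  rw [Finset.image_image, Finset.image_image,
    Finset.card_image_of_injective _ fun a b e => (Prod.ext_iff.1 e).1] at this
  rw [show (Prod.fst ∘ fun a => (a, g a)) = id from rfl, Finset.image_id] at this
  exact this

end IsPartialOfType

/-- Every finite part of a map of type `x` extends to a permutation of type `y`, provided that `x`
and `y` agree up to the size of that part. -/
theorem HasType.exists_perm_eqOn {e : ℕ → ℕ} (he : Function.Injective e) {x y : ℕ → ZMod 2}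
    (hx : HasType e x) (s : Finset ℕ) (hxy : ∀ n ≤ s.card, x n = y n) :
    ∃ g : Equiv.Perm ℕ, (∀ a ∈ s, g a = e a) ∧ HasType g y := by
  have : IsPartialOfType y (s.image fun a => (a, e a)) := by
    refine ⟨?_, fun t ht => ?_⟩
    · simp only [Finset.mem_image]
      rintro _ ⟨a, _, rfl⟩ _ ⟨b, _, rfl⟩
      exact he.eq_iff.symm
    · obtain ⟨t', ht', rfl⟩ := Finset.subset_image_iff.1 ht
      rw [Finset.image_image, Finset.image_image,
        Finset.card_image_of_injective _ fun a b e => (Prod.ext_iff.1 e).1,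
        show (Prod.fst ∘ fun a => (a, e a)) = id from rfl, Finset.image_id,
        ← hxy _ (Finset.card_le_card ht')]
      exact hx t'
  obtain ⟨g, h1, h2⟩ := this.exists_perm
  exact ⟨g, fun a ha => h1 (a, e a) (Finset.mem_image_of_mem _ ha), h2⟩

/-- Every sequence that vanishes at `0` is the type of a permutation. The coordinate at `0` concerns
the empty set, whose colour cannot change. -/
theorem exists_perm_hasType {x : ℕ → ZMod 2} (hx : x 0 = 0) :
    ∃ g : Equiv.Perm ℕ, HasType g x := by
  have : IsPartialOfType x ∅ := by
    refine ⟨by simp, fun t ht => ?_⟩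
    rw [Finset.subset_empty.1 ht]
    simp [hx]
  obtain ⟨g, -, h⟩ := this.exists_perm
  exact ⟨g, h⟩

namespace HasType

theorem id : HasType id 0 := fun s => by simp

theorem comp {e e' : ℕ → ℕ} {x x' : ℕ → ZMod 2} (h : HasType e x) (h' : HasType e' x')
    (inj : Function.Injective e') : HasType (e ∘ e') (x + x') := fun s => by
  rw [← Finset.image_image, h, h', Finset.card_image_of_injective _ inj, Pi.add_apply, add_assoc,
    add_comm (x' _)]

theorem symm {g : Equiv.Perm ℕ} {x : ℕ → ZMod 2} (h : HasType g x) : HasType g.symm x := fun s => by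
  have := h (s.image g.symm)
  rw [Finset.image_image, Equiv.self_comp_symm, Finset.image_id,
    Finset.card_image_of_injective _ g.symm.injective] at this
  rw [this, add_assoc, CharTwo.add_self_eq_zero, add_zero]

theorem apply_zero {e : ℕ → ℕ} {x : ℕ → ZMod 2} (hx : HasType e x) : x 0 = 0 := by
  simpa using hx ∅

end HasType

/-- Having a type is a local property of a map. -/
theorem exists_hasType_of_local {e : ℕ → ℕ}
    (h : ∀ s : Finset ℕ, ∃ e' x, HasType e' x ∧ ∀ a ∈ s, e' a = e a) : ∃ x, HasType e x := by
  refine ⟨fun n => color ((Finset.range n).image e) + color (Finset.range n), fun s => ?_⟩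
  obtain ⟨e', x, hx, hs⟩ := h (s ∪ Finset.range s.card)
  have h1 : s.image e = s.image e' :=
    Finset.image_congr fun a ha => (hs a (Finset.mem_union_left _ ha)).symm
  have h2 : (Finset.range s.card).image e = (Finset.range s.card).image e' :=
    Finset.image_congr fun a ha => (hs a (Finset.mem_union_right _ ha)).symm
  simp only [h1, h2]
  rw [hx s, hx (Finset.range s.card), Finset.card_range, add_comm (color (Finset.range _)),
    add_assoc, CharTwo.add_self_eq_zero, add_zero]

/-! ### The clone of a transformation monoid -/

section UnaryClone

/-- The clone of all operations that apply an element of a transformation monoid `M` to one of the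
arguments. -/
def unaryClone (M X : Type*) [Monoid M] [MulAction M X] : FunctionClone X where
  ops k := {f | ∃ (j : Fin k) (m : M), f = fun x => m • x j}
  proj_mem k j := ⟨j, 1, by simp⟩
  comp_mem n m f g := by
    rintro ⟨j, a, rfl⟩ hg
    obtain ⟨j', b, hb⟩ := hg j
    exact ⟨j', a * b, by simp [hb, mul_smul]⟩

theorem isLocallyClosed_unaryClone {M X : Type*} [Monoid M] [MulAction M X]
    (h : ∀ F : X → X, (∀ s : Finset X, ∃ m : M, ∀ x ∈ s, m • x = F x) →
      ∃ m : M, ∀ x, m • x = F x) : IsLocallyClosed (unaryClone M X) := by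
  classical
  intro k f hf
  -- A single coordinate works for all finite sets, since there are only finitely many coordinates.
  have h1 : ∃ j : Fin k, ∀ s : Finset (Fin k → X), ∃ m : M, ∀ x ∈ s, m • x j = f x := by
    by_contra hn
    push Not at hn
    choose s hs using hn
    obtain ⟨_, ⟨j, m, rfl⟩, hg⟩ := hf (Finset.univ.biUnion s)
    obtain ⟨x, hx, hne⟩ := hs j m
    exact hne (hg x (Finset.mem_biUnion.2 ⟨j, Finset.mem_univ _, hx⟩))
  obtain ⟨j, hj⟩ := h1
  obtain ⟨m, hm⟩ := h (fun a => f fun _ => a) fun s => by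
    obtain ⟨m, hm⟩ := hj (s.image fun a _ => a)
    exact ⟨m, fun a ha => hm _ (Finset.mem_image_of_mem _ ha)⟩
  refine ⟨j, m, funext fun x => ?_⟩
  obtain ⟨m', hm'⟩ := hj {x, fun _ => x j}
  rw [hm, ← hm' x (by simp), ← hm' (fun _ => x j) (by simp)]

/-- No element of the monoid acts as a constant map. -/
def NoConstants (M X : Type*) [Monoid M] [MulAction M X] : Prop :=
  ∀ m : M, ∃ x y : X, m • x ≠ m • y

variable {M X : Type*} [Monoid M] [MulAction M X]

/-- In the absence of constants, an operation of the clone determines the argument on which it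
depends and the monoid element. -/
noncomputable def unaryOpEquiv [FaithfulSMul M X] (hM : NoConstants M X) (k : ℕ+) :
    Fin k × M ≃ (unaryClone M X).ops k :=
  Equiv.ofBijective (fun p => ⟨fun x => p.2 • x p.1, p.1, p.2, rfl⟩) <| by
    classical
    constructor
    · rintro ⟨j, m⟩ ⟨j', m'⟩ h
      have h' : ∀ x : Fin k → X, m • x j = m' • x j' := fun x => congrFun (Subtype.ext_iff.1 h) x
      have hm : m = m' := FaithfulSMul.eq_of_smul_eq_smul fun a : X => h' fun _ => a
      subst hm
      have hj : j = j' := by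
        by_contra hne
        obtain ⟨a, b, hab⟩ := hM m
        have := h' (fun i => if i = j then a else b)
        rw [if_pos rfl, if_neg (Ne.symm hne)] at this
        exact hab this
      rw [hj]
    · rintro ⟨_, j, m, rfl⟩
      exact ⟨(j, m), rfl⟩

theorem unaryOpEquiv_comp [FaithfulSMul M X] (hM : NoConstants M X) {n k : ℕ+}
    (p : Fin n × M) (q : Fin n → Fin k × M) :
    (unaryClone M X).comp (unaryOpEquiv hM n p) (fun i => unaryOpEquiv hM k (q i)) =
      unaryOpEquiv hM k ((q p.1).1, p.2 * (q p.1).2) :=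
  Subtype.ext (funext fun x => (mul_smul p.2 (q p.1).2 (x (q p.1).1)).symm)

variable {M' X' : Type*} [Monoid M'] [MulAction M' X'] [FaithfulSMul M X] [FaithfulSMul M' X']

theorem isomorphic_unaryClone (hM : NoConstants M X) (hM' : NoConstants M' X') (φ : M ≃* M') :
    (unaryClone M X).Isomorphic (unaryClone M' X') := by
  -- The operation `x ↦ m • x j` is sent to `x ↦ φ m • x j`.
  let E : ∀ k : ℕ+, (unaryClone M X).ops k ≃ (unaryClone M' X').ops k := fun k =>
    (unaryOpEquiv hM k).symm.trans
      (((Equiv.refl _).prodCongr φ.toEquiv).trans (unaryOpEquiv hM' k))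
  have hE : ∀ k p, E k (unaryOpEquiv hM k p) = unaryOpEquiv hM' k (p.1, φ p.2) := by
    intro k p
    simp only [E, Equiv.trans_apply, Equiv.symm_apply_apply]
    rfl
  refine ⟨⟨E, fun k i => ?_, fun n m f g => ?_⟩⟩
  · have h1 : (unaryClone M X).proj k i = unaryOpEquiv hM k (i, 1) :=
      Subtype.ext (funext fun x => (one_smul M (x i)).symm)
    have h2 : (unaryClone M' X').proj k i = unaryOpEquiv hM' k (i, 1) :=
      Subtype.ext (funext fun x => (one_smul M' (x i)).symm)
    rw [h1, h2, hE, map_one]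
  · obtain ⟨p, rfl⟩ := (unaryOpEquiv hM n).surjective f
    obtain ⟨q, rfl⟩ : ∃ q : Fin n → Fin m × M, (fun i => unaryOpEquiv hM m (q i)) = g :=
      ⟨fun i => (unaryOpEquiv hM m).symm (g i), by simp⟩
    rw [unaryOpEquiv_comp]
    simp only [hE]
    rw [unaryOpEquiv_comp, map_mul]

/-- A topological isomorphism of the clones restricts to a continuous isomorphism of the monoids,
for the topologies of pointwise convergence. -/
theorem exists_mulEquiv_of_topologicallyIsomorphic (hM : NoConstants M X)
    (hM' : NoConstants M' X')
    (h : (unaryClone M X).TopologicallyIsomorphic (unaryClone M' X')) :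
    ∃ ψ : M ≃* M', ∀ (m : M) (y : X'), ∃ s : Finset X, ∀ m' : M,
      (∀ x ∈ s, m' • x = m • x) → ψ m' • y = ψ m • y := by
  classical
  obtain ⟨ξ, hξ⟩ := h
  let _ : Unique (Fin (1 : ℕ+)) := inferInstanceAs (Unique (Fin 1))
  let u : M ≃ (unaryClone M X).ops 1 :=
    (Equiv.uniqueProd M (Fin (1 : ℕ+))).symm.trans (unaryOpEquiv hM 1)
  let u' : M' ≃ (unaryClone M' X').ops 1 :=
    (Equiv.uniqueProd M' (Fin (1 : ℕ+))).symm.trans (unaryOpEquiv hM' 1)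
  have hu : ∀ a b, u (a * b) = (unaryClone M X).comp (u a) fun _ => u b := fun a b =>
    Subtype.ext (funext fun x => mul_smul a b (x default))
  have hu' : ∀ a b, u' (a * b) = (unaryClone M' X').comp (u' a) fun _ => u' b := fun a b =>
    Subtype.ext (funext fun x => mul_smul a b (x default))
  let ψ : M ≃ M' := u.trans ((ξ.toEquiv 1).trans u'.symm)
  have hψ : ∀ m, u' (ψ m) = ξ.toEquiv 1 (u m) := fun m =>
    u'.apply_symm_apply (ξ.toEquiv 1 (u m))
  refine ⟨⟨ψ, fun a b => ?_⟩, fun m y => ?_⟩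
  · apply u'.injective
    change u' (ψ (a * b)) = u' (ψ a * ψ b)
    rw [hψ, hu, ξ.map_comp, hu', hψ, hψ]
  · obtain ⟨s, hs⟩ := ξ.exists_finset_of_continuous hξ.continuous (u m) fun _ => y
    refine ⟨s.image fun x => x default, fun m' hm' => ?_⟩
    have := hs (u m') fun x hx => hm' _ (Finset.mem_image_of_mem _ hx)
    rw [← hψ, ← hψ] at this
    exact this

end UnaryClone

/-! ### Two transformation monoids -/

/-- Addition on `{0, 1, 2}`, truncated at `2`. Addition of `Fin 3` itself would be modulo `3`. -/
def truncAdd (c d : Fin 3) : Fin 3 := ⟨min 2 (c.1 + d.1), by omega⟩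

/-- A self-map of `ℕ` together with a sign in `ℤ/2` and a degree in `{0, 1, 2}`. Degrees add up,
but everything above degree `2` is identified with degree `2`. -/
@[ext] structure GradedMap where
  /-- The underlying map. -/
  map : ℕ → ℕ
  /-- The sign. -/
  sign : ZMod 2
  /-- The degree. -/
  deg : Fin 3

namespace GradedMap

instance : Monoid GradedMap where
  mul a b := ⟨a.map ∘ b.map, a.sign + b.sign, truncAdd a.deg b.deg⟩
  one := ⟨id, 0, 0⟩
  mul_assoc a b c := GradedMap.ext rfl (add_assoc _ _ _)
    ((by decide : ∀ x y z, truncAdd (truncAdd x y) z = truncAdd x (truncAdd y z)) _ _ _)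
  one_mul a := GradedMap.ext rfl (zero_add _) ((by decide : ∀ x, truncAdd 0 x = x) _)
  mul_one a := GradedMap.ext rfl (add_zero _) ((by decide : ∀ x, truncAdd x 0 = x) _)

theorem mul_def (a b : GradedMap) :
    a * b = ⟨a.map ∘ b.map, a.sign + b.sign, truncAdd a.deg b.deg⟩ := rfl

end GradedMap

/-- The common domain of the two structures: the coloured set `ℕ`, and a copy of the finite monoid
of signs and degrees. -/
abbrev Point : Type := ℕ ⊕ (ZMod 2 × Fin 3)

namespace GradedMap

instance : MulAction GradedMap Point where
  smul a p := p.map a.map fun q => (a.sign + q.1, truncAdd a.deg q.2)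
  one_smul p := by
    rcases p with n | ⟨i, d⟩
    · rfl
    · exact congrArg Sum.inr (Prod.ext (zero_add _) ((by decide : ∀ x, truncAdd 0 x = x) _))
  mul_smul a b p := by
    rcases p with n | ⟨i, d⟩
    · rfl
    · exact congrArg Sum.inr (Prod.ext (add_assoc _ _ _)
        ((by decide : ∀ x y z, truncAdd (truncAdd x y) z = truncAdd x (truncAdd y z)) _ _ _))

theorem smul_inl (a : GradedMap) (n : ℕ) : a • (Sum.inl n : Point) = Sum.inl (a.map n) := rfl

theorem smul_inr (a : GradedMap) (q : ZMod 2 × Fin 3) :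
    a • (Sum.inr q : Point) = Sum.inr (a.sign + q.1, truncAdd a.deg q.2) := rfl

theorem smul_inr_zero (a : GradedMap) : a • (Sum.inr (0, 0) : Point) = Sum.inr (a.sign, a.deg) := by
  rw [smul_inr, add_zero, (by decide : ∀ x, truncAdd x 0 = x)]

instance : FaithfulSMul GradedMap Point where
  eq_of_smul_eq_smul {a b} h := by
    have h0 := h (Sum.inr (0, 0))
    rw [smul_inr_zero, smul_inr_zero, Sum.inr.injEq, Prod.mk.injEq] at h0
    refine GradedMap.ext (funext fun n => ?_) h0.1 h0.2
    exact Sum.inl_injective (h (Sum.inl n))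

end GradedMap

/-- The sequence `0, 1, 1, 1, …`, the largest type of a permutation. -/
def onesType (n : ℕ) : ZMod 2 := if n = 0 then 0 else 1

/-- The types `x` that are allowed for elements with sign `i` and degree `d`. In degree `1` these
are the types with at most one nonzero entry, with sign `0`, and `onesType`, with sign `κ`. -/
structure IsAllowed (κ i : ZMod 2) (d : Fin 3) (x : ℕ → ZMod 2) : Prop where
  deg_zero : d = 0 → i = 0 ∧ x = 0
  deg_one : d = 1 → ((∀ n m, x n ≠ 0 → x m ≠ 0 → n = m) ∧ i = 0) ∨ (x = onesType ∧ i = κ)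

/-- The set of allowed types is closed. -/
theorem isAllowed_of_local {κ i : ZMod 2} {d : Fin 3} {x : ℕ → ZMod 2}
    (h : ∀ N, ∃ y, IsAllowed κ i d y ∧ ∀ n ≤ N, y n = x n) : IsAllowed κ i d x := by
  refine ⟨fun hd => ?_, fun hd => ?_⟩
  · refine ⟨?_, funext fun n => ?_⟩
    · obtain ⟨y, hy, -⟩ := h 0
      exact (hy.deg_zero hd).1
    · obtain ⟨y, hy, hn⟩ := h n
      rw [← hn n le_rfl, (hy.deg_zero hd).2]
  · by_contra hc
    rw [not_or] at hc
    obtain ⟨h1, h2⟩ := hc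
    -- Each of the two alternatives fails for a reason visible on an initial segment.
    have h1' : ∃ N, ∀ y : ℕ → ZMod 2, (∀ n ≤ N, y n = x n) →
        ¬((∀ n m, y n ≠ 0 → y m ≠ 0 → n = m) ∧ i = 0) := by
      by_contra hN
      push Not at hN
      refine h1 ⟨fun n m hn hm => ?_, ?_⟩
      · obtain ⟨y, hy, hy', -⟩ := hN (max n m)
        refine hy' n m ?_ ?_
        · rwa [hy n (le_max_left _ _)]
        · rwa [hy m (le_max_right _ _)]
      · obtain ⟨y, -, -, hi⟩ := hN 0
        exact hi
    have h2' : ∃ N, ∀ y : ℕ → ZMod 2, (∀ n ≤ N, y n = x n) → ¬(y = onesType ∧ i = κ) := by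
      by_contra hN
      push Not at hN
      refine h2 ⟨funext fun n => ?_, ?_⟩
      · obtain ⟨y, hy, hy', -⟩ := hN n
        rw [← hy n le_rfl, hy']
      · obtain ⟨y, -, -, hi⟩ := hN 0
        exact hi
    obtain ⟨N₁, h1'⟩ := h1'
    obtain ⟨N₂, h2'⟩ := h2'
    obtain ⟨y, hy, hyx⟩ := h (max N₁ N₂)
    rcases hy.deg_one hd with hy | hy
    · exact h1' y (fun n hn => hyx n (hn.trans (le_max_left _ _))) hy
    · exact h2' y (fun n hn => hyx n (hn.trans (le_max_right _ _))) hy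

theorem isAllowed_zero (κ : ZMod 2) : IsAllowed κ 0 0 0 :=
  ⟨fun _ => ⟨rfl, rfl⟩, fun h => absurd h (by decide)⟩

theorem isAllowed_one_single (κ : ZMod 2) (N : ℕ) : IsAllowed κ 0 1 (Pi.single N 1) := by
  have hs : ∀ n, (Pi.single N 1 : ℕ → ZMod 2) n ≠ 0 → n = N := fun n hn => by
    by_contra h
    exact hn (Pi.single_eq_of_ne h 1)
  exact ⟨fun h => absurd h (by decide),
    fun _ => Or.inl ⟨fun n m hn hm => (hs n hn).trans (hs m hm).symm, rfl⟩⟩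

theorem isAllowed_one_onesType (κ : ZMod 2) : IsAllowed κ κ 1 onesType :=
  ⟨fun h => absurd h (by decide), fun _ => Or.inr ⟨rfl, rfl⟩⟩

theorem isAllowed_two (κ i : ZMod 2) (x : ℕ → ZMod 2) : IsAllowed κ i 2 x :=
  ⟨fun h => absurd h (by decide), fun h => absurd h (by decide)⟩

theorem IsAllowed.add {κ i j : ZMod 2} {c d : Fin 3} {x y : ℕ → ZMod 2} (hx : IsAllowed κ i c x)
    (hy : IsAllowed κ j d y) : IsAllowed κ (i + j) (truncAdd c d) (x + y) := by
  by_cases hc : c = 0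
  · obtain ⟨rfl, rfl⟩ := hx.deg_zero hc
    rwa [hc, zero_add, zero_add, (by decide : ∀ x, truncAdd 0 x = x)]
  by_cases hd : d = 0
  · obtain ⟨rfl, rfl⟩ := hy.deg_zero hd
    rwa [hd, add_zero, add_zero, (by decide : ∀ x, truncAdd x 0 = x)]
  rw [(by decide : ∀ c d : Fin 3, c ≠ 0 → d ≠ 0 → truncAdd c d = 2) c d hc hd]
  exact isAllowed_two _ _ _

/-- The monoid of injections with an allowed type. -/
def typedMonoid (κ : ZMod 2) : Submonoid GradedMap where
  carrier := {a | Function.Injective a.map ∧ ∃ x, HasType a.map x ∧ IsAllowed κ a.sign a.deg x}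
  one_mem' := ⟨Function.injective_id, 0, HasType.id, isAllowed_zero κ⟩
  mul_mem' := by
    rintro a b ⟨ha, x, hx, hx'⟩ ⟨hb, y, hy, hy'⟩
    exact ⟨ha.comp hb, x + y, hx.comp hy hb, hx'.add hy'⟩

theorem noConstants_typedMonoid (κ : ZMod 2) : NoConstants (typedMonoid κ) Point := fun a =>
  ⟨Sum.inl 0, Sum.inl 1, fun h => absurd (a.2.1 (Sum.inl_injective h)) (by decide)⟩

theorem isLocallyClosed_typedMonoid (κ : ZMod 2) :
    IsLocallyClosed (unaryClone (typedMonoid κ) Point) := by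
  classical
  refine isLocallyClosed_unaryClone fun F hF => ?_
  obtain ⟨⟨i, d⟩, hid⟩ : ∃ q, F (Sum.inr (0, 0)) = Sum.inr q := by
    obtain ⟨a, ha⟩ := hF {Sum.inr (0, 0)}
    exact ⟨_, (ha _ (by simp)).symm.trans (GradedMap.smul_inr_zero a.1)⟩
  -- The sign and degree are read off at one point, so the approximations may be taken with a fixed
  -- sign and degree.
  have hF' : ∀ s : Finset Point, ∃ a ∈ typedMonoid κ, a.sign = i ∧ a.deg = d ∧
      ∀ p ∈ s, a • p = F p := by
    intro s
    obtain ⟨a, ha⟩ := hF (insert (Sum.inr (0, 0)) s)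
    have h0 := (ha _ (by simp)).symm.trans (GradedMap.smul_inr_zero a.1)
    rw [hid, Sum.inr.injEq, Prod.mk.injEq] at h0
    exact ⟨a, a.2, h0.1.symm, h0.2.symm, fun p hp => ha p (Finset.mem_insert_of_mem hp)⟩
  have he : ∀ n, ∃ m, F (Sum.inl n) = Sum.inl m := by
    intro n
    obtain ⟨a, -, -, -, ha⟩ := hF' {Sum.inl n}
    exact ⟨_, (ha _ (by simp)).symm⟩
  choose e he using he
  have hloc : ∀ s : Finset ℕ, ∃ a ∈ typedMonoid κ, a.sign = i ∧ a.deg = d ∧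
      ∀ n ∈ s, a.map n = e n := by
    intro s
    obtain ⟨a, ha, hi, hd, h⟩ := hF' (s.image Sum.inl)
    refine ⟨a, ha, hi, hd, fun n hn => ?_⟩
    have := h _ (Finset.mem_image_of_mem _ hn)
    rw [he, GradedMap.smul_inl] at this
    exact Sum.inl_injective this
  have hinj : Function.Injective e := by
    intro n m hnm
    obtain ⟨a, ha, -, -, h⟩ := hloc {n, m}
    apply ha.1
    rw [h n (by simp), h m (by simp), hnm]
  obtain ⟨x, hx⟩ : ∃ x, HasType e x := exists_hasType_of_local fun s => by
    obtain ⟨a, ⟨-, y, hy, -⟩, -, -, h⟩ := hloc s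
    exact ⟨a.map, y, hy, h⟩
  have hall : IsAllowed κ i d x := isAllowed_of_local fun N => by
    obtain ⟨a, ⟨-, y, hy, hy'⟩, hi, hd, h⟩ := hloc (Finset.range N)
    rw [hi, hd] at hy'
    refine ⟨y, hy', fun n hn => ?_⟩
    have h1 := hy (Finset.range n)
    have h2 := hx (Finset.range n)
    rw [Finset.image_congr (g := e) fun m hm => h m (Finset.range_mono hn hm), h2,
      Finset.card_range] at h1
    exact (add_left_cancel h1).symm
  refine ⟨⟨⟨e, i, d⟩, hinj, x, hx, hall⟩, fun p => ?_⟩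
  rcases p with n | q
  · exact (he n).symm
  · obtain ⟨a, -, hi, hd, h⟩ := hF' {Sum.inr q}
    rw [← h _ (by simp), GradedMap.smul_inr, hi, hd]
    rfl

/-- The automorphism group of the canonical structure has finitely many orbits on tuples: the orbit
of a tuple is determined by its finite part, the equalities between its entries, and the colours
of the sets of entries in `ℕ`. -/
theorem oligomorphic_typedMonoid (κ : ZMod 2) :
    let _ := canonicalStructure (unaryClone (typedMonoid κ) Point)
    Oligomorphic (matrixLanguage Point) Point := by
  classical
  intro _ n
  let num : Point → ℕ := Sum.elim id fun _ => 0
  refine ⟨(Fin n → Option (ZMod 2 × Fin 3)) × (Fin n → Fin n → Prop) ×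
    (Finset (Fin n) → ZMod 2), inferInstance,
    fun a => (fun i => (a i).getRight?, fun i j => a i = a j,
      fun s => color (s.image fun i => num (a i))), fun a b hab => ?_⟩
  simp only [Prod.mk.injEq] at hab
  obtain ⟨h1, h2, h3⟩ := hab
  let l : Finset (ℕ × ℕ) :=
    (Finset.univ.filter fun i => (a i).isLeft).image fun i => (num (a i), num (b i))
  have hbl : ∀ i, (a i).isLeft → (b i).isLeft := by
    intro i hi
    have := congrFun h1 i
    revert this hi
    rcases a i with u | u <;> rcases b i with v | v <;> simp
  have hnum : ∀ p : Point, p.isLeft → p = Sum.inl (num p) := by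
    rintro (u | u) <;> simp [num]
  have hl : IsPartialOfType 0 l := by
    refine ⟨?_, fun t ht => ?_⟩
    · simp only [l, Finset.mem_image, Finset.mem_filter, Finset.mem_univ, true_and]
      rintro _ ⟨i, hi, rfl⟩ _ ⟨j, hj, rfl⟩
      have h := iff_of_eq (congrFun (congrFun h2 i) j)
      rw [hnum _ hi, hnum _ hj, hnum _ (hbl i hi), hnum _ (hbl j hj), Sum.inl.injEq,
        Sum.inl.injEq] at h
      exact h
    · obtain ⟨s, -, rfl⟩ := Finset.subset_image_iff.1 ht
      rw [Finset.image_image, Finset.image_image, Pi.zero_apply, add_zero]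
      exact (congrFun h3 s).symm
  obtain ⟨g, hg, hg'⟩ := hl.exists_perm
  have hmem : ∀ f : Equiv.Perm ℕ, HasType f 0 → (⟨f, 0, 0⟩ : GradedMap) ∈ typedMonoid κ :=
    fun f hf => ⟨f.injective, 0, hf, isAllowed_zero κ⟩
  have hact : ∀ (f : Equiv.Perm ℕ) (p : Point),
      (⟨f, 0, 0⟩ : GradedMap) • p = Equiv.sumCongr f (Equiv.refl _) p := by
    rintro f (m | ⟨i, d⟩)
    · rfl
    · rw [GradedMap.smul_inr, zero_add, (by decide : ∀ x, truncAdd 0 x = x)]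
      rfl
  obtain ⟨h, hh⟩ := exists_canonical_equiv (unaryClone (typedMonoid κ) Point)
    (Equiv.sumCongr g (Equiv.refl _))
    ⟨0, ⟨_, hmem g hg'⟩, funext fun x => (hact g (x 0)).symm⟩
    ⟨0, ⟨_, hmem g.symm hg'.symm⟩, funext fun x => (hact g.symm (x 0)).symm⟩
  refine ⟨h, fun i => ?_⟩
  rw [hh]
  have h1i := congrFun h1 i
  by_cases hi : (a i).isLeft
  · rw [hnum _ hi, hnum _ (hbl i hi)]
    exact congrArg Sum.inl (hg (num (a i), num (b i)) (Finset.mem_image.2 ⟨i, by simp [hi], rfl⟩))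
  · revert h1i hi
    rcases a i with u | u <;> rcases b i with v | v <;> simp

/-! ### The algebraic isomorphism -/

/-- The limit of a sequence in `ℤ/2` along a nonprincipal ultrafilter. -/
noncomputable def ultraLimit (x : ℕ → ZMod 2) : ZMod 2 :=
  open Classical in if ∀ᶠ n in (Filter.hyperfilter ℕ : Filter ℕ), x n = 1 then 1 else 0

theorem eventually_eq_ultraLimit (x : ℕ → ZMod 2) :
    ∀ᶠ n in (Filter.hyperfilter ℕ : Filter ℕ), x n = ultraLimit x := by
  by_cases h : ∀ᶠ n in (Filter.hyperfilter ℕ : Filter ℕ), x n = 1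
  · rwa [ultraLimit, if_pos h]
  · rw [ultraLimit, if_neg h]
    exact (Ultrafilter.eventually_not.2 h).mono fun n hn =>
      (by decide : ∀ z : ZMod 2, z ≠ 1 → z = 0) _ hn

theorem ultraLimit_eq {x : ℕ → ZMod 2} {z : ZMod 2}
    (h : ∀ᶠ n in (Filter.hyperfilter ℕ : Filter ℕ), x n = z) : ultraLimit x = z := by
  obtain ⟨n, h1, h2⟩ := ((eventually_eq_ultraLimit x).and h).exists
  exact h1.symm.trans h2

theorem ultraLimit_add (x y : ℕ → ZMod 2) :
    ultraLimit (x + y) = ultraLimit x + ultraLimit y :=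
  ultraLimit_eq <| ((eventually_eq_ultraLimit x).and (eventually_eq_ultraLimit y)).mono
    fun n hn => by rw [Pi.add_apply, hn.1, hn.2]

theorem ultraLimit_eq_of_finite {x : ℕ → ZMod 2} {z : ZMod 2} (h : {n | x n ≠ z}.Finite) :
    ultraLimit x = z :=
  ultraLimit_eq <| Filter.Eventually.mono
    (Filter.hyperfilter_le_cofinite h.eventually_cofinite_notMem) fun _ hn => not_not.1 hn

/-- The type of a map, a junk value if the map has no type. -/
def typeOf (e : ℕ → ℕ) (n : ℕ) : ZMod 2 :=
  color ((Finset.range n).image e) + color (Finset.range n)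

theorem HasType.typeOf_eq {e : ℕ → ℕ} {x : ℕ → ZMod 2} (h : HasType e x) : typeOf e = x := by
  funext n
  rw [typeOf, h, Finset.card_range, add_right_comm, CharTwo.add_self_eq_zero, zero_add]

/-- Change of the sign by the limit of the type. -/
noncomputable def twist (a : GradedMap) : GradedMap :=
  ⟨a.map, a.sign + ultraLimit (typeOf a.map), a.deg⟩

theorem twist_twist (a : GradedMap) : twist (twist a) = a :=
  GradedMap.ext rfl (by simp [twist, add_assoc, CharTwo.add_self_eq_zero]) rfl

theorem IsAllowed.twist {κ i : ZMod 2} {d : Fin 3} {x : ℕ → ZMod 2} (h : IsAllowed κ i d x) :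
    IsAllowed (κ + 1) (i + ultraLimit x) d x := by
  refine ⟨fun hd => ?_, fun hd => ?_⟩
  · obtain ⟨rfl, rfl⟩ := h.deg_zero hd
    exact ⟨by rw [ultraLimit_eq_of_finite (z := 0) (by simp), add_zero], rfl⟩
  · rcases h.deg_one hd with ⟨hx, rfl⟩ | ⟨rfl, rfl⟩
    · refine Or.inl ⟨hx, ?_⟩
      have : {n | x n ≠ 0}.Finite := Set.Subsingleton.finite fun n hn m hm => hx n m hn hm
      rw [ultraLimit_eq_of_finite this, add_zero]
    · refine Or.inr ⟨rfl, ?_⟩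
      have : {n | onesType n ≠ 1}.Finite :=
        (Set.finite_singleton 0).subset fun n hn => by
          by_contra hn0
          exact hn (if_neg hn0)
      rw [ultraLimit_eq_of_finite this]

theorem twist_mem {κ : ZMod 2} {a : GradedMap} (h : a ∈ typedMonoid κ) :
    twist a ∈ typedMonoid (κ + 1) := by
  obtain ⟨h1, x, hx, hx'⟩ := h
  refine ⟨h1, x, hx, ?_⟩
  have := hx'.twist
  rwa [← hx.typeOf_eq] at this ⊢

theorem twist_mul {κ : ZMod 2} {a b : GradedMap} (ha : a ∈ typedMonoid κ)
    (hb : b ∈ typedMonoid κ) : twist (a * b) = twist a * twist b := by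
  obtain ⟨h1, x, hx, -⟩ := ha
  obtain ⟨h2, y, hy, -⟩ := hb
  refine GradedMap.ext rfl ?_ rfl
  simp only [twist, GradedMap.mul_def]
  rw [(hx.comp hy h2).typeOf_eq, hx.typeOf_eq, hy.typeOf_eq, ultraLimit_add]
  abel

/-- Adding a discontinuous character of the group of types to the sign identifies the two
monoids. -/
noncomputable def twistEquiv : typedMonoid 1 ≃* typedMonoid 0 where
  toFun a := ⟨twist a, twist_mem a.2⟩
  invFun a := ⟨twist a, by
    have := twist_mem a.2
    rwa [zero_add] at this⟩
  left_inv a := Subtype.ext (twist_twist a)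
  right_inv a := Subtype.ext (twist_twist a)
  map_mul' a b := Subtype.ext (twist_mul a.2 b.2)

/-! ### The absence of a topological isomorphism -/

/-- The element of degree `2` with a given map and sign. -/
def topElement (κ : ZMod 2) (e : ℕ → ℕ) (he : Function.Injective e) (hx : ∃ x, HasType e x)
    (i : ZMod 2) : typedMonoid κ :=
  ⟨⟨e, i, 2⟩, he, hx.imp fun x hx => ⟨hx, isAllowed_two κ i x⟩⟩

/-- The idempotent `(id, 0, 2)`. -/
def idem (κ : ZMod 2) : typedMonoid κ :=
  topElement κ id Function.injective_id ⟨0, HasType.id⟩ 0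

theorem idem_mul_idem (κ : ZMod 2) : idem κ * idem κ = idem κ := rfl

theorem idem_ne_one (κ : ZMod 2) : idem κ ≠ 1 := fun h =>
  absurd (show (2 : Fin 3) = 0 from congrArg (fun a : typedMonoid κ => a.1.deg) h) (by decide)

theorem mul_idem_eq_iff {κ : ZMod 2} (a : typedMonoid κ) : a * idem κ = a ↔ a.1.deg = 2 := by
  constructor
  · intro h
    rw [← h]
    exact (by decide : ∀ d, truncAdd d 2 = 2) _
  · intro h
    refine Subtype.ext (GradedMap.ext rfl (add_zero _) ?_)
    change truncAdd a.1.deg 2 = a.1.deg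
    rw [h]
    rfl

/-- `idem` is the only nontrivial idempotent, since idempotent injections are trivial. -/
theorem eq_idem_of_idempotent {κ : ZMod 2} {a : typedMonoid κ} (h : a * a = a) (h1 : a ≠ 1) :
    a = idem κ := by
  have hmap : a.1.map = id := by
    funext n
    exact a.2.1 (congrFun (congrArg (fun a : typedMonoid κ => a.1.map) h) n)
  have hsign : a.1.sign = 0 := by
    have : a.1.sign + a.1.sign = a.1.sign := congrArg (fun a : typedMonoid κ => a.1.sign) h
    simpa using this
  have hdeg : truncAdd a.1.deg a.1.deg = a.1.deg :=
    congrArg (fun a : typedMonoid κ => a.1.deg) h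
  rcases (by decide : ∀ d, truncAdd d d = d → d = 0 ∨ d = 2) _ hdeg with hd | hd
  · exact absurd (Subtype.ext (GradedMap.ext hmap hsign hd)) h1
  · exact Subtype.ext (GradedMap.ext hmap hsign hd)

/-- An isomorphism preserves degree `2`, because it preserves the only nontrivial idempotent. -/
theorem deg_eq_two_iff_of_mulEquiv {κ κ' : ZMod 2} (ψ : typedMonoid κ ≃* typedMonoid κ')
    (a : typedMonoid κ) : (ψ a).1.deg = 2 ↔ a.1.deg = 2 := by
  have h : ψ (idem κ) = idem κ' := by
    apply eq_idem_of_idempotent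
    · rw [← map_mul, idem_mul_idem]
    · rw [Ne, EmbeddingLike.map_eq_one_iff]
      exact idem_ne_one κ
  rw [← mul_idem_eq_iff, ← mul_idem_eq_iff, ← h, ← map_mul, EmbeddingLike.apply_eq_iff_eq]

theorem sign_eq_zero_of_deg_ne_two {a : typedMonoid 0} (h : a.1.deg ≠ 2) : a.1.sign = 0 := by
  obtain ⟨-, x, -, hx⟩ := a.2
  rcases (by decide : ∀ d : Fin 3, d ≠ 2 → d = 0 ∨ d = 1) _ h with hd | hd
  · exact (hx.deg_zero hd).1
  · rcases hx.deg_one hd with h | h <;> exact h.2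

/-- A character of `typedMonoid 1` that is continuous and trivial in degrees `0` and `1` is
trivial. In degree `2` and sign `0` it vanishes on permutations of finitely supported type, which
are products of elements of degree at most `1` and `idem`, and these are dense. The elements of
type `onesType` then show that it does not depend on the sign. -/
theorem character_eq_zero (χ : typedMonoid 1 → ZMod 2) (hmul : ∀ a b, χ (a * b) = χ a + χ b)
    (hcont : ∀ a, ∃ s : Finset Point, ∀ b : typedMonoid 1, (∀ p ∈ s, b • p = a • p) → χ b = χ a)
    (hdeg : ∀ a, a.1.deg ≠ 2 → χ a = 0) (a : typedMonoid 1) : χ a = 0 := by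
  classical
  have hidem : χ (idem 1) = 0 := by
    have := hmul (idem 1) (idem 1)
    rw [idem_mul_idem] at this
    simpa using this
  have hfin : ∀ (N : ℕ) (g : Equiv.Perm ℕ) (x : ℕ → ZMod 2) (hx : HasType g x),
      (∀ n, N ≤ n → x n = 0) → χ (topElement 1 g g.injective ⟨x, hx⟩ 0) = 0 := by
    intro N
    induction N with
    | zero =>
      intro g x hx h0
      obtain rfl : x = 0 := funext fun n => h0 n n.zero_le
      let b : typedMonoid 1 := ⟨⟨g, 0, 0⟩, g.injective, 0, hx, isAllowed_zero 1⟩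
      have hb : b.1.deg ≠ 2 := show (0 : Fin 3) ≠ 2 by decide
      have : topElement 1 g g.injective ⟨0, hx⟩ 0 = b * idem 1 := rfl
      rw [this, hmul, hidem, add_zero, hdeg b hb]
    | succ N ih =>
      intro g x hx h0
      by_cases hN : x N = 0
      · refine ih g x hx fun n hn => ?_
        rcases hn.eq_or_lt with rfl | hn
        · exact hN
        · exact h0 n hn
      have hN1 : x N = 1 := (by decide : ∀ z : ZMod 2, z ≠ 0 → z = 1) _ hN
      have hN0 : 0 ≠ N := fun h => hN (h ▸ hx.apply_zero)
      -- Composition with a permutation whose type is the `N`-th unit vector clears `x N`.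
      obtain ⟨f, hf⟩ := exists_perm_hasType (x := Pi.single N 1) (Pi.single_eq_of_ne hN0 1)
      let b : typedMonoid 1 := ⟨⟨f, 0, 1⟩, f.injective, _, hf, isAllowed_one_single 1 N⟩
      have hb : b.1.deg ≠ 2 := show (1 : Fin 3) ≠ 2 by decide
      have h1 : χ (topElement 1 (g * f : Equiv.Perm ℕ) (g * f).injective
          ⟨_, hx.comp hf f.injective⟩ 0) = 0 := by
        refine ih (g * f) _ (hx.comp hf f.injective) fun n hn => ?_
        rcases hn.eq_or_lt with rfl | hn
        · rw [Pi.add_apply, Pi.single_eq_same, hN1]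
          decide
        · rw [Pi.add_apply, h0 n hn, Pi.single_eq_of_ne hn.ne', add_zero]
      have h2 : topElement 1 (g * f : Equiv.Perm ℕ) (g * f).injective
          ⟨_, hx.comp hf f.injective⟩ 0 = topElement 1 g g.injective ⟨x, hx⟩ 0 * b := rfl
      rwa [h2, hmul, hdeg b hb, add_zero] at h1
  have hzero : ∀ e he hx, χ (topElement 1 e he hx 0) = 0 := by
    rintro e he ⟨x, hx⟩
    obtain ⟨s, hs⟩ := hcont (topElement 1 e he ⟨x, hx⟩ 0)
    let t : Finset ℕ := s.preimage Sum.inl Sum.inl_injective.injOn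
    obtain ⟨f, hf, hf'⟩ := hx.exists_perm_eqOn he t
      (y := fun n => if n ≤ t.card then x n else 0) fun n hn => (if_pos hn).symm
    rw [← hs (topElement 1 f f.injective ⟨_, hf'⟩ 0) ?_]
    · exact hfin (t.card + 1) f _ hf' fun n hn => if_neg (by omega)
    · rintro (n | q) hp
      · exact congrArg Sum.inl (hf n (Finset.mem_preimage.2 hp))
      · rfl
  have hsign : ∀ i, χ (topElement 1 id Function.injective_id ⟨0, HasType.id⟩ i) = 0 := by
    obtain ⟨w, hw⟩ := exists_perm_hasType (x := onesType) rfl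
    let b : typedMonoid 1 := ⟨⟨w, 1, 1⟩, w.injective, _, hw, isAllowed_one_onesType 1⟩
    have hb : b.1.deg ≠ 2 := show (1 : Fin 3) ≠ 2 by decide
    have h1 : χ (b * idem 1) = 0 := by rw [hmul, hidem, hdeg b hb, add_zero]
    have h2 : b * idem 1 = topElement 1 id Function.injective_id ⟨0, HasType.id⟩ 1 *
        topElement 1 w w.injective ⟨_, hw⟩ 0 := rfl
    rw [h2, hmul, hzero, add_zero] at h1
    intro i
    rcases (by decide : ∀ z : ZMod 2, z = 0 ∨ z = 1) i with rfl | rfl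
    · exact hidem
    · exact h1
  by_cases hd : a.1.deg = 2
  · obtain ⟨⟨e, i, d⟩, he, x, hx, h⟩ := a
    obtain rfl : d = 2 := hd
    have : (⟨⟨e, i, 2⟩, he, x, hx, h⟩ : typedMonoid 1) =
        topElement 1 id Function.injective_id ⟨0, HasType.id⟩ i * topElement 1 e he ⟨x, hx⟩ 0 :=
      Subtype.ext (GradedMap.ext rfl (add_zero i).symm rfl)
    rw [this, hmul, hsign, hzero, add_zero]
  · exact hdeg a hd

theorem not_topologicallyIsomorphic_typedMonoid :
    ¬ (unaryClone (typedMonoid 1) Point).TopologicallyIsomorphic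
      (unaryClone (typedMonoid 0) Point) := by
  intro h
  obtain ⟨ψ, hψ⟩ := exists_mulEquiv_of_topologicallyIsomorphic (noConstants_typedMonoid 1)
    (noConstants_typedMonoid 0) h
  have key := character_eq_zero (fun a => (ψ a).1.sign)
    (fun a b => by rw [map_mul]; rfl)
    (fun a => by
      obtain ⟨s, hs⟩ := hψ a (Sum.inr (0, 0))
      refine ⟨s, fun b hb => ?_⟩
      have := (GradedMap.smul_inr_zero (ψ b).1).symm.trans
        ((hs b hb).trans (GradedMap.smul_inr_zero (ψ a).1))
      rw [Sum.inr.injEq, Prod.mk.injEq] at this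
      exact this.1)
    (fun a ha => sign_eq_zero_of_deg_ne_two
      fun h2 => ha ((deg_eq_two_iff_of_mulEquiv ψ a).1 h2))
  have h1 := key (ψ.symm (topElement 0 id Function.injective_id ⟨0, HasType.id⟩ 1))
  simp only [MulEquiv.apply_symm_apply] at h1
  exact absurd h1 (show (1 : ZMod 2) ≠ 0 by decide)

end FunctionClones

theorem mainTheorem3 :
    ∃ (L₁ L₂ : FirstOrder.Language.{0, 0}) (A B : Type)
      (_ : L₁.Structure A) (_ : L₂.Structure B),
      (L₁.IsRelational ∧ Countable L₁.Symbols ∧ Countable A ∧ Infinite A ∧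
        FunctionClones.IsOmegaCategorical L₁ A) ∧
      (L₂.IsRelational ∧ Countable L₂.Symbols ∧ Countable B ∧ Infinite B ∧
        FunctionClones.IsOmegaCategorical L₂ B) ∧
      (FunctionClones.Pol L₁ A).Isomorphic (FunctionClones.Pol L₂ B) ∧
      ¬ (FunctionClones.Pol L₁ A).TopologicallyIsomorphic (FunctionClones.Pol L₂ B) := by
  open FunctionClones in
  let S (κ : ZMod 2) := canonicalStructure (unaryClone (typedMonoid κ) Point)
  have hpol (κ : ZMod 2) : @Pol (matrixLanguage Point) Point (S κ) =
      unaryClone (typedMonoid κ) Point := pol_canonicalStructure _ (isLocallyClosed_typedMonoid κ)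
  have hcat (κ : ZMod 2) : @IsOmegaCategorical (matrixLanguage Point) Point (S κ) :=
    @Oligomorphic.isOmegaCategorical _ _ (S κ) inferInstance (oligomorphic_typedMonoid κ)
  refine ⟨matrixLanguage Point, matrixLanguage Point, Point, Point, S 1, S 0,
    ⟨inferInstance, inferInstance, inferInstance, inferInstance, hcat 1⟩,
    ⟨inferInstance, inferInstance, inferInstance, inferInstance, hcat 0⟩, ?_, ?_⟩
  · rw [hpol, hpol]
    exact isomorphic_unaryClone (noConstants_typedMonoid 1) (noConstants_typedMonoid 0) twistEquiv
  · rw [hpol, hpol]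
    exact not_topologicallyIsomorphic_typedMonoid
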